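/- Consider quantum query algorithms accessing a black box $x\in\{0,1\}^N$. Such an algorithm with $T$ queries is a unitary transformation $U_TOU_{T-1}O\cdots OU_1OU_0$ on finitely many qubits applied to the initial state $|\vec 0\rangle$, where the $U_i$ are arbitrary unitary transformations independent of $x$ and $O$ is the query gate $|j,b,z\rangle\mapsto|j,b\oplus x_j,z\rangle$ (acting as the identity on basis states whose address register does not name a variable); its output is the result of measuring one designated qubit of the final state. For $f:\{0,1\}^N\to\{0,1\}$ let $Q_2(f)$ be the least $T$ for which some such algorithm with $T$ queries outputs $f(x)$ with probability at least $2/3$ for every $x\in\{0,1\}^N$. A (loopless) directed graph on $n$ vertices is represented by $N=n(n-1)$ bits, an undirected one by $N=n(n-1)/2$ bits, one bit for each possible edge, saying whether that edge is present. A nontrivial monotone graph property on $n$ vertices is a function $P:\{0,1\}^N\to\{0,1\}$ that is non-constant, invariant under permutations of the vertices, and monotone (adding edges cannot change the value from $1$ to $0$). **Theorem.** The following hold for directed graphs and also for undirected graphs. 1. There is a universal constant $c>0$ such that $Q_2(P)\ge c\sqrt n$ for every $n$ and every nontrivial monotone graph property $P$ on $n$ vertices; that is, $Q_2(P)\in\Omega(\sqrt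 n)$. 2. The property $P_n$ "the graph has at least one edge" is a nontrivial monotone graph property for every $n\ge 2$, and there is a constant $C>0$ such that $Q_2(P_n)\le Cn$ for every $n$; that is, $Q_2(P_n)\in O(n)$. -/

import Mathlib

open scoped ENNReal

/-! ## Quantum query networks -/

/-- Computational basis states of a network with `a` address qubits, one answer qubit and
`w + 1` work qubits: triples `(address, answer bit, work bits)`. The rightmost (last) work qubit
is the output qubit. -/
abbrev BasisState (a w : ℕ) : Type := (Fin a → Bool) × Bool × (Fin (w + 1) → Bool)

/-- The bit that the black box `x` holds at the address `u`: it is `x j` if `u` is the address of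
the variable `j`, and `false` if no variable has the address `u`. -/
noncomputable def bitAt {ι : Type} {a : ℕ} (address : ι ↪ (Fin a → Bool)) (x : ι → Bool)
    (u : Fin a → Bool) : Bool :=
  open Classical in decide (∃ j, address j = u ∧ x j = true)

/-- The query gate `O` of the black box `x`: it maps `|j, b, z⟩` to `|j, b ⊕ x_j, z⟩` (and leaves
`|u, b, z⟩` alone if `u` is not the address of a variable). -/
noncomputable def queryGate {ι : Type} {a : ℕ} (w : ℕ) (address : ι ↪ (Fin a → Bool))
    (x : ι → Bool) : Matrix (BasisState a w) (BasisState a w) ℂ :=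
  Matrix.of fun s t => if s = (t.1, xor t.2.1 (bitAt address x t.1), t.2.2) then 1 else 0

/-- A quantum network making `queries` queries to a black box of Boolean variables indexed by `ι`.
It is given by the numbers of its qubits, by the binary addresses of the variables, and by the
unitary transformations `U 0, …, U queries`, which do not depend on the black box (later values
of `U` are never used). -/
structure QueryNetwork (ι : Type) where
  queries : ℕ
  addressQubits : ℕ
  workQubits : ℕ
  address : ι ↪ (Fin addressQubits → Bool)
  U : ℕ → Matrix.unitaryGroup (BasisState addressQubits workQubits) ℂ

namespace QueryNetwork

variable {ι : Type} (A : QueryNetwork ι)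

/-- The product `U_t O U_{t-1} O ⋯ O U_1 O U_0` on the black box `x`. -/
noncomputable def transform (x : ι → Bool) : ℕ →
    Matrix (BasisState A.addressQubits A.workQubits) (BasisState A.addressQubits A.workQubits) ℂ
  | 0 => (A.U 0).1
  | t + 1 => (A.U (t + 1)).1 * queryGate A.workQubits A.address x * transform x t

/-- The initial basis state, all of whose qubits are `0`. -/
def initial : BasisState A.addressQubits A.workQubits := (fun _ => false, false, fun _ => false)

/-- The final superposition on the black box `x`. -/
noncomputable def finalState (x : ι → Bool) : BasisState A.addressQubits A.workQubits → ℂ :=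
  (A.transform x A.queries).mulVec (Pi.single A.initial 1)

/-- The probability that measuring the output qubit of the final state yields the bit `b`. -/
noncomputable def outputProb (x : ι → Bool) (b : Bool) : ℝ :=
  ∑ s : BasisState A.addressQubits A.workQubits,
    if s.2.2 (Fin.last A.workQubits) = b then ‖A.finalState x s‖ ^ 2 else 0

/-- The network computes `f` with bounded error: on every black box `x` it outputs `f x` with
probability at least `2/3`. -/
def ComputesBoundedError (f : (ι → Bool) → Bool) : Prop :=
  ∀ x : ι → Bool, 2 / 3 ≤ A.outputProb x (f x)

end QueryNetwork

/-- The bounded-error quantum query complexity `Q₂(f)`: the least number of queries made by a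
network that computes `f` with bounded error (`⊤` if there were none). -/
noncomputable def Q₂ {ι : Type} (f : (ι → Bool) → Bool) : ℕ∞ :=
  ⨅ (A : QueryNetwork ι) (_ : A.ComputesBoundedError f), (A.queries : ℕ∞)

/-! ## Directed graphs -/

/-- The `n (n - 1)` possible edges of a directed graph on `n` vertices. A directed graph is
represented by the vector `Arc n → Bool` telling which edges are present. -/
abbrev Arc (n : ℕ) : Type := {p : Fin n × Fin n // p.1 ≠ p.2}

/-- The action of a permutation of the vertices on the possible directed edges. -/
def Arc.relabel {n : ℕ} (σ : Equiv.Perm (Fin n)) (e : Arc n) : Arc n :=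
  ⟨(σ e.1.1, σ e.1.2), σ.injective.ne e.2⟩

/-- A nontrivial monotone property of directed graphs on `n` vertices: invariant under permutation
of the vertices, monotone (adding edges cannot destroy it), and non-constant. -/
structure IsNontrivialMonotoneDigraphProperty {n : ℕ} (P : (Arc n → Bool) → Bool) : Prop where
  invariant : ∀ (σ : Equiv.Perm (Fin n)) (x : Arc n → Bool), P (fun e => x (e.relabel σ)) = P x
  monotone : Monotone P
  nonconstant : ∃ x y, P x ≠ P y

/-! ## Undirected graphs -/

/-- The `n (n - 1) / 2` possible edges of an undirected graph on `n` vertices. An undirected graph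
is represented by the vector `Edge n → Bool` telling which edges are present. -/
abbrev Edge (n : ℕ) : Type := {e : Sym2 (Fin n) // ¬ e.IsDiag}

/-- The action of a permutation of the vertices on the possible undirected edges. -/
def Edge.relabel {n : ℕ} (σ : Equiv.Perm (Fin n)) (e : Edge n) : Edge n :=
  ⟨e.1.map σ, fun h => e.2 ((Sym2.isDiag_map σ.injective).1 h)⟩

/-- A nontrivial monotone property of undirected graphs on `n` vertices. -/
structure IsNontrivialMonotoneGraphProperty {n : ℕ} (P : (Edge n → Bool) → Bool) : Prop where
  invariant : ∀ (σ : Equiv.Perm (Fin n)) (x : Edge n → Bool), P (fun e => x (e.relabel σ)) = P x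
  monotone : Monotone P
  nonconstant : ∃ x y, P x ≠ P y

/-! ## The property of having an edge -/

/-- The property "there is at least one edge" of a graph with possible edges `ι`. -/
noncomputable def hasEdge {ι : Type} (x : ι → Bool) : Bool :=
  open Classical in decide (∃ e, x e = true)

/-! Lower bound: by the hybrid argument, a network with `T` queries has at most `100 T ^ 2`
sensitive variables at any input (`card_sensitive_le`). Flipping a sensitive variable must move the
final state by a constant distance, while each query can move it by at most twice the magnitude
spent on that variable, and at each time the squared magnitudes sum to at most 1. For a monotone
property take a minimal graph `x` having it and a maximal graph `y` lacking it. The present edges of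
`x` and the absent edges of `y` are all sensitive. If together they touched at most `n` vertices, a
permutation would separate them, and a copy of `x` would be a subgraph of `y`, contradicting
monotonicity. Hence `n` is at most `400 T ^ 2` (`vertices_le_queries_sq`).

Upper bound: searching `N` addresses takes `O(√N)` queries, even though the number of marked ones is
unknown. Let `W` be the Grover step and `u` the uniform superposition. Without marked elements `W u
= u`, so the average of `W ^ j u` over `j < M` is `u`. Otherwise `u = v - W v` with `‖v‖ ^ 2 ≤ N /
4`, so the sum telescopes and the average has squared norm at most `N / M ^ 2`
(`l2norm_sum_walk_sq_le`). The network runs all step counts `j < M = 2 ^ m` in superposition and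
then projects the counter onto its uniform state; the probability of the answer "no edge" is the
squared norm of that average (`searchNetwork_outputProb_false`). -/

/-! ## The Euclidean norm on complex vectors -/

/-- The Euclidean norm of a complex vector. -/
noncomputable def l2norm {κ : Type*} [Fintype κ] (v : κ → ℂ) : ℝ :=
  ‖(WithLp.toLp 2 v : EuclideanSpace ℂ κ)‖

section Norm

variable {κ : Type*} [Fintype κ]

theorem l2norm_nonneg (v : κ → ℂ) : 0 ≤ l2norm v := norm_nonneg _

theorem l2norm_sq (v : κ → ℂ) : l2norm v ^ 2 = ∑ i, ‖v i‖ ^ 2 :=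
  EuclideanSpace.norm_sq_eq _

theorem l2norm_add_le (v w : κ → ℂ) : l2norm (v + w) ≤ l2norm v + l2norm w := by
  simpa [l2norm] using norm_add_le (WithLp.toLp 2 v) (WithLp.toLp 2 w)

theorem l2norm_sub_le (v w : κ → ℂ) : l2norm (v - w) ≤ l2norm v + l2norm w := by
  simpa [l2norm] using norm_sub_le (WithLp.toLp 2 v) (WithLp.toLp 2 w)

theorem l2norm_smul (c : ℂ) (v : κ → ℂ) : l2norm (c • v) = ‖c‖ * l2norm v := by
  simpa [l2norm] using norm_smul c (WithLp.toLp 2 v)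

theorem l2norm_comp_equiv (e : κ ≃ κ) (v : κ → ℂ) : l2norm (fun i => v (e i)) = l2norm v := by
  rw [← sq_eq_sq₀ (l2norm_nonneg _) (l2norm_nonneg _), l2norm_sq, l2norm_sq]
  exact e.sum_comp fun i => ‖v i‖ ^ 2

/-- A vector that is pointwise smaller has the smaller norm. -/
theorem l2norm_mono {v w : κ → ℂ} (h : ∀ i, ‖v i‖ ≤ ‖w i‖) : l2norm v ≤ l2norm w := by
  rw [← sq_le_sq₀ (l2norm_nonneg _) (l2norm_nonneg _), l2norm_sq, l2norm_sq]
  gcongr with i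
  exact h i

theorem l2norm_sq_eq_dotProduct (v : κ → ℂ) : ((l2norm v ^ 2 : ℝ) : ℂ) = star v ⬝ᵥ v := by
  rw [l2norm_sq, dotProduct]
  push_cast
  refine Finset.sum_congr rfl fun i _ => ?_
  rw [Pi.star_apply, RCLike.star_def, Complex.conj_mul']

theorem l2norm_mulVec [DecidableEq κ] {U : Matrix κ κ ℂ} (hU : U ∈ Matrix.unitaryGroup κ ℂ)
    (v : κ → ℂ) : l2norm (U.mulVec v) = l2norm v := by
  rw [← sq_eq_sq₀ (l2norm_nonneg _) (l2norm_nonneg _)]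
  have h := Matrix.mem_unitaryGroup_iff'.1 hU
  apply Complex.ofReal_injective
  rw [l2norm_sq_eq_dotProduct, l2norm_sq_eq_dotProduct, Matrix.star_mulVec,
    Matrix.dotProduct_mulVec, Matrix.vecMul_vecMul, ← Matrix.star_eq_conjTranspose, h,
    Matrix.vecMul_one]

theorem l2norm_single [DecidableEq κ] (i : κ) : l2norm (Pi.single i 1 : κ → ℂ) = 1 := by
  simp [l2norm]

end Norm

/-! ## Evolution of the state of a network -/

/-- The permutation of the basis states that the query gate performs. -/
noncomputable def queryEquiv {ι : Type} {a : ℕ} (w : ℕ) (address : ι ↪ (Fin a → Bool))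
    (x : ι → Bool) : BasisState a w ≃ BasisState a w :=
  Function.Involutive.toPerm (fun t => (t.1, xor t.2.1 (bitAt address x t.1), t.2.2)) <| by
    rintro ⟨u, b, z⟩
    simp

theorem queryEquiv_apply {ι : Type} {a : ℕ} (w : ℕ) (address : ι ↪ (Fin a → Bool))
    (x : ι → Bool) (t : BasisState a w) :
    queryEquiv w address x t = (t.1, xor t.2.1 (bitAt address x t.1), t.2.2) := rfl

theorem queryEquiv_queryEquiv {ι : Type} {a : ℕ} (w : ℕ) (address : ι ↪ (Fin a → Bool))
    (x : ι → Bool) (t : BasisState a w) :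
    queryEquiv w address x (queryEquiv w address x t) = t := by
  simp [queryEquiv_apply]

theorem queryGate_mulVec {ι : Type} {a : ℕ} (w : ℕ) (address : ι ↪ (Fin a → Bool))
    (x : ι → Bool) (ψ : BasisState a w → ℂ) :
    (queryGate w address x).mulVec ψ = fun s => ψ (queryEquiv w address x s) := by
  funext s
  simp only [Matrix.mulVec, dotProduct, queryGate, Matrix.of_apply, ← queryEquiv_apply]
  refine (Finset.sum_eq_single (queryEquiv w address x s) ?_ (by simp)).trans ?_
  · intro t _ ht
    have hst : s ≠ queryEquiv w address x t := by
      rintro rfl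
      exact ht (queryEquiv_queryEquiv w address x t).symm
    simp [hst]
  · simp [queryEquiv_queryEquiv]

theorem bitAt_address {ι : Type} {a : ℕ} (address : ι ↪ (Fin a → Bool)) (x : ι → Bool) (j : ι) :
    bitAt address x (address j) = x j := by
  simp [bitAt]

namespace QueryNetwork

variable {ι : Type} (A : QueryNetwork ι)

/-- The state after `t` queries to `x`. -/
noncomputable def state (x : ι → Bool) (t : ℕ) :
    BasisState A.addressQubits A.workQubits → ℂ :=
  (A.transform x t).mulVec (Pi.single A.initial 1)

theorem state_zero (x : ι → Bool) :
    A.state x 0 = (A.U 0).1.mulVec (Pi.single A.initial 1) := rfl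

theorem state_succ (x : ι → Bool) (t : ℕ) :
    A.state x (t + 1) = (A.U (t + 1)).1.mulVec
      (fun s => A.state x t (queryEquiv A.workQubits A.address x s)) := by
  rw [← queryGate_mulVec, state, transform, ← Matrix.mulVec_mulVec, ← Matrix.mulVec_mulVec]
  rfl

theorem l2norm_state (x : ι → Bool) (t : ℕ) : l2norm (A.state x t) = 1 := by
  induction t with
  | zero => rw [state_zero, l2norm_mulVec (A.U 0).2, l2norm_single]
  | succ t ih => rw [state_succ, l2norm_mulVec (A.U (t + 1)).2, l2norm_comp_equiv, ih]

theorem outputProb_eq (x : ι → Bool) (b : Bool) :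
    A.outputProb x b = l2norm (fun s => if s.2.2 (Fin.last A.workQubits) = b
      then A.state x A.queries s else 0) ^ 2 := by
  rw [l2norm_sq, outputProb]
  refine Finset.sum_congr rfl fun s _ => ?_
  split_ifs
  · rfl
  · simp

theorem outputProb_add_not (x : ι → Bool) (b : Bool) :
    A.outputProb x b + A.outputProb x (!b) = 1 := by
  have h := l2norm_sq (A.state x A.queries)
  rw [l2norm_state, one_pow] at h
  rw [h, outputProb, outputProb, ← Finset.sum_add_distrib]
  refine Finset.sum_congr rfl fun s _ => ?_
  cases b <;> cases s.2.2 (Fin.last A.workQubits) <;> simp [finalState, state]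

/-! ## The hybrid argument -/

/-- The magnitude with which the state after `t` queries to `x` asks for the variable `i`. -/
noncomputable def queryMagnitude (x : ι → Bool) (i : ι) (t : ℕ) : ℝ :=
  l2norm (fun s => if s.1 = A.address i then A.state x t s else 0)

/-- Distinct variables have distinct addresses, so these are norms of components of one unit vector
with disjoint supports. -/
theorem sum_queryMagnitude_sq_le (x : ι → Bool) (S : Finset ι) (t : ℕ) :
    ∑ i ∈ S, A.queryMagnitude x i t ^ 2 ≤ 1 := by
  have h := l2norm_sq (A.state x t)
  rw [l2norm_state, one_pow] at h
  rw [h]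
  simp only [queryMagnitude, l2norm_sq]
  rw [Finset.sum_comm]
  gcongr with s
  by_cases hs : ∃ i ∈ S, s.1 = A.address i
  · obtain ⟨i, hi, his⟩ := hs
    rw [Finset.sum_eq_single_of_mem i hi, if_pos his]
    intro j _ hj
    rw [if_neg, norm_zero, zero_pow two_ne_zero]
    intro h
    exact hj (A.address.injective (h.symm.trans his))
  · rw [Finset.sum_eq_zero]
    · positivity
    · intro i hi
      rw [if_neg fun h => hs ⟨i, hi, h⟩, norm_zero, zero_pow two_ne_zero]

theorem bitAt_congr {a : ℕ} (address : ι ↪ (Fin a → Bool)) {x y : ι → Bool} {i : ι}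
    (h : ∀ j, j ≠ i → x j = y j) {u : Fin a → Bool} (hu : u ≠ address i) :
    bitAt address x u = bitAt address y u := by
  unfold bitAt
  congr 1
  refine propext (exists_congr fun j => and_congr_right fun hj => ?_)
  rw [h j]
  rintro rfl
  exact hu hj.symm

/-- If `x` and `y` differ in the variable `i` only, then one query moves the states apart by at
most twice the query magnitude. -/
theorem l2norm_state_sub_succ_le {x y : ι → Bool} {i : ι} (h : ∀ j, j ≠ i → x j = y j) (t : ℕ) :
    l2norm (A.state x (t + 1) - A.state y (t + 1)) ≤
      l2norm (A.state x t - A.state y t) + 2 * A.queryMagnitude x i t := by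
  set w := A.workQubits
  set p : BasisState A.addressQubits w → ℂ :=
    fun s => if s.1 = A.address i then A.state x t s else 0 with hp
  -- The hybrid step `O_x ψ_x - O_y ψ_y = O_y (ψ_x - ψ_y) + (O_x - O_y) ψ_x`; the two gates agree
  -- off the address of `i`, so in the last term `ψ_x` may be replaced by its component `p`.
  have key : (fun s => A.state x t (queryEquiv w A.address x s)) -
      (fun s => A.state y t (queryEquiv w A.address y s)) =
      (fun s => (A.state x t - A.state y t) (queryEquiv w A.address y s)) +
      ((fun s => p (queryEquiv w A.address x s)) - fun s => p (queryEquiv w A.address y s)) := by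
    funext s
    simp only [Pi.sub_apply, Pi.add_apply, hp]
    by_cases hs : s.1 = A.address i
    · simp only [queryEquiv_apply, hs, if_true]
      ring
    · have hq : queryEquiv w A.address x s = queryEquiv w A.address y s := by
        rw [queryEquiv_apply, queryEquiv_apply, bitAt_congr A.address h hs]
      rw [hq]
      ring
  have hpm : l2norm p = A.queryMagnitude x i t := rfl
  rw [state_succ, state_succ, ← Matrix.mulVec_sub, l2norm_mulVec (A.U (t + 1)).2, key]
  refine (l2norm_add_le _ _).trans ?_
  rw [l2norm_comp_equiv (queryEquiv w A.address y) (A.state x t - A.state y t)]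
  gcongr
  refine (l2norm_sub_le _ _).trans_eq ?_
  rw [l2norm_comp_equiv, l2norm_comp_equiv, hpm]
  ring

theorem l2norm_state_sub_le {x y : ι → Bool} {i : ι} (h : ∀ j, j ≠ i → x j = y j) (t : ℕ) :
    l2norm (A.state x t - A.state y t) ≤ 2 * ∑ r ∈ Finset.range t, A.queryMagnitude x i r := by
  induction t with
  | zero => simp [state_zero, l2norm]
  | succ t ih =>
    rw [Finset.sum_range_succ, mul_add]
    exact (A.l2norm_state_sub_succ_le h t).trans (by gcongr)

/-- Projecting both final states onto the output `f x` does not increase their distance, and the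
projections have norms at least `√(2/3)` and at most `√(1/3)`. -/
theorem le_l2norm_state_sub {f : (ι → Bool) → Bool} (hA : A.ComputesBoundedError f)
    {x y : ι → Bool} (h : f x ≠ f y) :
    1 / 5 ≤ l2norm (A.state x A.queries - A.state y A.queries) := by
  have hx := hA x
  have hy := hA y
  have hy' := A.outputProb_add_not y (f y)
  rw [show (!f y) = f x by revert h; cases f x <;> cases f y <;> simp] at hy'
  have hy2 : A.outputProb y (f x) ≤ 1 / 3 := by linarith
  rw [outputProb_eq] at hx hy2
  set v : _ → ℂ := fun s => if s.2.2 (Fin.last A.workQubits) = f x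
    then A.state x A.queries s else 0 with hv
  set w : _ → ℂ := fun s => if s.2.2 (Fin.last A.workQubits) = f x
    then A.state y A.queries s else 0 with hw
  have h1 : l2norm (v - w) ≤ l2norm (A.state x A.queries - A.state y A.queries) := by
    refine l2norm_mono fun s => ?_
    simp only [hv, hw, Pi.sub_apply]
    split_ifs
    · rfl
    · simp
  have h2 : l2norm v ≤ l2norm w + l2norm (v - w) := by
    simpa using l2norm_add_le w (v - w)
  -- Rational bounds suffice: `16/25 ≤ 2/3` here and `1/3 ≤ 9/25` below.
  have h3 : 4 / 5 ≤ l2norm v := by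
    refine le_of_sq_le_sq ?_ (l2norm_nonneg v)
    linarith
  have h4 : l2norm w ≤ 3 / 5 := by
    refine abs_le_of_sq_le_sq' ?_ (by norm_num) |>.2
    linarith
  linarith

/-- The number of sensitive variables at any input is at most `100 T ^ 2`. -/
theorem card_sensitive_le {f : (ι → Bool) → Bool} (hA : A.ComputesBoundedError f) (x : ι → Bool)
    (S : Finset ι) (hS : ∀ i ∈ S, ∃ y, (∀ j, j ≠ i → x j = y j) ∧ f x ≠ f y) :
    (S.card : ℝ) ≤ 100 * (A.queries : ℝ) ^ 2 := by
  -- The magnitudes of `i` over all queries sum to at least `1/10`; Cauchy–Schwarz turns this into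
  -- squares, which can be summed over `S`.
  have h1 : ∀ i ∈ S, (1 : ℝ) / 100 ≤
      A.queries * ∑ r ∈ Finset.range A.queries, A.queryMagnitude x i r ^ 2 := by
    intro i hi
    obtain ⟨y, hy, hf⟩ := hS i hi
    have h := (A.le_l2norm_state_sub hA hf).trans (A.l2norm_state_sub_le hy A.queries)
    have h' := sq_sum_le_card_mul_sum_sq (s := Finset.range A.queries)
      (f := fun r => A.queryMagnitude x i r)
    rw [Finset.card_range] at h'
    nlinarith
  have h2 := Finset.sum_le_sum h1
  rw [Finset.sum_const, nsmul_eq_mul, ← Finset.mul_sum, Finset.sum_comm] at h2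
  have h3 : ∑ r ∈ Finset.range A.queries, ∑ i ∈ S, A.queryMagnitude x i r ^ 2 ≤ A.queries := by
    refine (Finset.sum_le_sum fun r _ => A.sum_queryMagnitude_sq_le x S r).trans ?_
    simp
  have h4 := mul_le_mul_of_nonneg_left h3 (Nat.cast_nonneg (α := ℝ) A.queries)
  linarith [sq (A.queries : ℝ)]

end QueryNetwork

/-! ## Lower bound for monotone graph properties -/

/-- If two sets of vertices are small enough, a permutation makes them disjoint. -/
theorem exists_perm_disjoint {n : ℕ} (V W : Finset (Fin n)) (h : V.card + W.card ≤ n) :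
    ∃ σ : Equiv.Perm (Fin n), ∀ v ∈ W, σ v ∉ V := by
  have hc : W.card ≤ Vᶜ.card := by
    rw [Finset.card_compl, Fintype.card_fin]
    omega
  obtain ⟨t, ht, htc⟩ := Finset.exists_subset_card_eq hc
  -- A bijection from `W` onto a subset of the complement of `V` extends to a permutation of all
  -- vertices.
  let e : {v // v ∈ W} ≃ {v // v ∈ t} := Finset.equivOfCardEq htc.symm
  refine ⟨e.extendSubtype, fun v hv => ?_⟩
  rw [e.extendSubtype_apply_of_mem v hv]
  exact Finset.mem_compl.1 (ht (e ⟨v, hv⟩).2)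

/-- A monotone non-constant function of the edges that is invariant under permutations of the `n`
vertices cannot be computed with fewer than `√n / 20` queries. -/
theorem vertices_le_queries_sq {ι : Type} [Fintype ι] {n : ℕ} (V : ι → Finset (Fin n))
    (hV : ∀ e, (V e).card = 2) (relabel : Equiv.Perm (Fin n) → ι → ι)
    (hr : ∀ σ e, ∀ v ∈ V e, σ v ∈ V (relabel σ e)) (P : (ι → Bool) → Bool)
    (hinv : ∀ σ x, P (fun e => x (relabel σ e)) = P x) (hmono : Monotone P)
    (hne : ∃ x y, P x ≠ P y) (A : QueryNetwork ι) (hA : A.ComputesBoundedError P) :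
    (n : ℝ) ≤ 400 * (A.queries : ℝ) ^ 2 := by
  classical
  obtain ⟨x₀, hx₀⟩ : ∃ x, P x = true := by
    obtain ⟨x, y, h⟩ := hne
    by_contra! H
    simp_all
  obtain ⟨y₀, hy₀⟩ : ∃ x, P x = false := by
    obtain ⟨x, y, h⟩ := hne
    by_contra! H
    simp_all
  obtain ⟨x, -, hx⟩ := (Set.toFinite {x | P x = true}).exists_le_minimal hx₀
  obtain ⟨y, -, hy⟩ := (Set.toFinite {x | P x = false}).exists_le_maximal hy₀
  set S := Finset.univ.filter fun e => x e = true with hS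
  set R := Finset.univ.filter fun e => y e = false with hR
  -- By minimality of `x`, deleting any present edge changes the value of `P`; dually for `y` below.
  have hSc : (S.card : ℝ) ≤ 100 * (A.queries : ℝ) ^ 2 := by
    refine A.card_sensitive_le hA x S fun i hi => ⟨Function.update x i false, ?_, ?_⟩
    · intro j hj
      simp [hj]
    · intro h
      have h1 : Function.update x i false ≤ x := by
        rw [update_le_iff]
        simp
      have h2 := hx.2 (h.symm.trans hx.1) h1 i
      simp_all only [Function.update_self, Finset.mem_filter, Finset.mem_univ, true_and]
      exact Bool.false_ne_true (Bool.le_iff_imp.1 h2 rfl)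
  have hRc : (R.card : ℝ) ≤ 100 * (A.queries : ℝ) ^ 2 := by
    refine A.card_sensitive_le hA y R fun i hi => ⟨Function.update y i true, ?_, ?_⟩
    · intro j hj
      simp [hj]
    · intro h
      have h1 : y ≤ Function.update y i true := by
        rw [le_update_iff]
        simp [Bool.le_true]
      have h2 := hy.2 (h.symm.trans hy.1) h1 i
      simp_all only [Function.update_self, Finset.mem_filter, Finset.mem_univ, true_and]
      exact Bool.false_ne_true (Bool.le_iff_imp.1 h2 rfl)
  have hVS : (S.biUnion V).card ≤ S.card * 2 :=
    Finset.card_biUnion_le_card_mul _ _ _ fun e _ => (hV e).le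
  have hVR : (R.biUnion V).card ≤ R.card * 2 :=
    Finset.card_biUnion_le_card_mul _ _ _ fun e _ => (hV e).le
  have hlt : n < (S.biUnion V).card + (R.biUnion V).card := by
    by_contra! hle
    obtain ⟨σ, hσ⟩ := exists_perm_disjoint _ _ hle
    -- An edge of the relabelled `x` that is absent from `y` would have an endpoint among the
    -- vertices of `R` that `σ` sends into those of `S`.
    have hxy : (fun e => x (relabel σ e)) ≤ y := by
      intro e
      rw [Bool.le_iff_imp]
      intro hxe
      by_contra hye
      rw [Bool.not_eq_true] at hye
      obtain ⟨v, hv⟩ : (V e).Nonempty := Finset.card_pos.1 (by rw [hV]; norm_num)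
      refine hσ v (Finset.mem_biUnion.2 ⟨e, by simp [hR, hye], hv⟩)
        (Finset.mem_biUnion.2 ⟨relabel σ e, by simp [hS, hxe], hr σ e v hv⟩)
    have h2 := hmono hxy
    rw [hinv, hx.1, hy.1] at h2
    exact Bool.false_ne_true (Bool.le_iff_imp.1 h2 rfl)
  have : (n : ℝ) ≤ 2 * S.card + 2 * R.card := by
    have : n ≤ 2 * S.card + 2 * R.card := by omega
    exact_mod_cast this
  linarith

theorem ofReal_sqrt_le_Q₂ {ι : Type} {f : (ι → Bool) → Bool} {n : ℕ}
    (h : ∀ A : QueryNetwork ι, A.ComputesBoundedError f → (n : ℝ) ≤ 400 * (A.queries : ℝ) ^ 2) :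
    ENNReal.ofReal (1 / 20 * Real.sqrt n) ≤ (Q₂ f : ℝ≥0∞) := by
  -- Query counts are integers, so rounding up lets the infimum be bounded within `ℕ∞`.
  have h1 : ((⌈1 / 20 * Real.sqrt n⌉₊ : ℕ) : ℕ∞) ≤ Q₂ f := by
    refine le_iInf₂ fun A hA => ?_
    rw [Nat.cast_le, Nat.ceil_le]
    have h2 : Real.sqrt n ≤ 20 * A.queries := by
      rw [Real.sqrt_le_left (by positivity)]
      linarith [h A hA, mul_pow 20 (A.queries : ℝ) 2]
    linarith
  refine le_trans ?_ (ENat.toENNReal_le.2 h1)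
  rw [ENat.toENNReal_coe, ENNReal.ofReal_le_iff_le_toReal (ENNReal.natCast_ne_top _)]
  simpa using Nat.le_ceil _

theorem ofReal_sqrt_le_Q₂_of_digraphProperty {n : ℕ} {P : (Arc n → Bool) → Bool}
    (hP : IsNontrivialMonotoneDigraphProperty P) :
    ENNReal.ofReal (1 / 20 * Real.sqrt n) ≤ (Q₂ P : ℝ≥0∞) := by
  refine ofReal_sqrt_le_Q₂ fun A hA => vertices_le_queries_sq (fun e : Arc n => {e.1.1, e.1.2})
    (fun e => Finset.card_pair e.2) Arc.relabel ?_ P hP.invariant hP.monotone hP.nonconstant A hA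
  intro σ e v hv
  simpa [Arc.relabel] using hv

theorem ofReal_sqrt_le_Q₂_of_graphProperty {n : ℕ} {P : (Edge n → Bool) → Bool}
    (hP : IsNontrivialMonotoneGraphProperty P) :
    ENNReal.ofReal (1 / 20 * Real.sqrt n) ≤ (Q₂ P : ℝ≥0∞) := by
  refine ofReal_sqrt_le_Q₂ fun A hA => vertices_le_queries_sq (fun e : Edge n => e.1.toFinset)
    (fun e => Sym2.card_toFinset_of_not_isDiag e.1 e.2) Edge.relabel ?_ P hP.invariant
    hP.monotone hP.nonconstant A hA
  intro σ e v hv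
  simp only [Sym2.mem_toFinset, Edge.relabel, Sym2.mem_map] at hv ⊢
  exact ⟨v, hv, rfl⟩

/-! ## Having an edge is a nontrivial monotone property -/

theorem hasEdge_monotone {ι : Type} : Monotone (hasEdge (ι := ι)) := by
  intro x y h
  rw [Bool.le_iff_imp]
  simp only [hasEdge, decide_eq_true_eq]
  rintro ⟨e, he⟩
  exact ⟨e, Bool.le_iff_imp.1 (h e) he⟩

theorem hasEdge_comp {ι : Type} {r : ι → ι} (hr : Function.Surjective r) (x : ι → Bool) :
    hasEdge (fun e => x (r e)) = hasEdge x := by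
  simp only [hasEdge, decide_eq_decide]
  exact (hr.exists (p := fun e => x e = true)).symm

theorem hasEdge_nonconstant {ι : Type} [Nonempty ι] : ∃ x y : ι → Bool, hasEdge x ≠ hasEdge y :=
  ⟨fun _ => true, fun _ => false, by simp [hasEdge]⟩

theorem isNontrivialMonotoneDigraphProperty_hasEdge {n : ℕ} (hn : 2 ≤ n) :
    IsNontrivialMonotoneDigraphProperty (n := n) hasEdge where
  invariant σ x := hasEdge_comp (fun e => ⟨e.relabel σ⁻¹, by simp [Arc.relabel]⟩) x
  monotone := hasEdge_monotone
  nonconstant :=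
    have : Nonempty (Arc n) := ⟨⟨(⟨0, by omega⟩, ⟨1, by omega⟩), by simp⟩⟩
    hasEdge_nonconstant

theorem isNontrivialMonotoneGraphProperty_hasEdge {n : ℕ} (hn : 2 ≤ n) :
    IsNontrivialMonotoneGraphProperty (n := n) hasEdge where
  invariant σ x := hasEdge_comp
    (fun e => ⟨e.relabel σ⁻¹, by simp [Edge.relabel, Sym2.map_map]⟩) x
  monotone := hasEdge_monotone
  nonconstant :=
    have : Nonempty (Edge n) := ⟨⟨s(⟨0, by omega⟩, ⟨1, by omega⟩), by simp⟩⟩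
    hasEdge_nonconstant

/-! ## Unitary matrices -/

section Unitary

variable {κ μ : Type*} [Fintype κ] [DecidableEq κ] [Fintype μ] [DecidableEq μ]

/-- The reflection that fixes the unit vector `v` and negates its orthogonal complement. -/
noncomputable def reflectionMatrix (v : κ → ℂ) : Matrix κ κ ℂ :=
  (2 : ℂ) • Matrix.vecMulVec v (star v) - 1

theorem reflectionMatrix_mulVec (v w : κ → ℂ) :
    (reflectionMatrix v).mulVec w = (2 * (star v ⬝ᵥ w)) • v - w := by
  rw [reflectionMatrix, Matrix.sub_mulVec, Matrix.smul_mulVec, Matrix.vecMulVec_mulVec,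
    Matrix.one_mulVec, op_smul_eq_smul, smul_smul]

theorem reflectionMatrix_mem {v : κ → ℂ} (hv : l2norm v = 1) :
    reflectionMatrix v ∈ Matrix.unitaryGroup κ ℂ := by
  have h1 : star v ⬝ᵥ v = 1 := by rw [← l2norm_sq_eq_dotProduct, hv]; simp
  have hs : star (reflectionMatrix v) = reflectionMatrix v := by
    rw [reflectionMatrix, star_sub, star_smul, star_one, Matrix.star_eq_conjTranspose,
      Matrix.conjTranspose_vecMulVec, star_star]
    simp
  rw [Matrix.mem_unitaryGroup_iff, hs, reflectionMatrix, sub_mul, mul_sub, one_mul, mul_one,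
    Matrix.smul_mul, Matrix.mul_smul, Matrix.vecMulVec_mul_vecMulVec, h1]
  simp only [one_smul]
  module

/-- Every unit vector with a nonnegative coordinate is the image of that basis vector under a
unitary matrix. -/
theorem exists_unitary_mulVec_single {v : κ → ℂ} (hv : l2norm v = 1) {i : κ} {r : ℝ}
    (hr : 0 ≤ r) (hi : v i = r) :
    ∃ U : Matrix.unitaryGroup κ ℂ, U.1.mulVec (Pi.single i 1) = v := by
  set e : κ → ℂ := Pi.single i 1 with he
  have hvv : star v ⬝ᵥ v = 1 := by rw [← l2norm_sq_eq_dotProduct, hv]; simp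
  have hse : star e = e := by rw [he, ← Pi.single_star, star_one]
  have hve : star v ⬝ᵥ e = r := by simp [he, hi]
  have hev : e ⬝ᵥ v = r := by simp [he, hi]
  have hee : e ⬝ᵥ e = 1 := by simp [he]
  -- The reflection fixing the direction of `e + v` swaps `e` and `v`, because their inner product
  -- `r` is real; `0 ≤ r` ensures that `e + v` is nonzero.
  have hpos : 0 < 2 + 2 * r := by linarith
  have hsum : star (e + v) ⬝ᵥ (e + v) = ((2 + 2 * r : ℝ) : ℂ) := by
    rw [star_add, add_dotProduct, dotProduct_add, dotProduct_add, hse, hee, hev, hve, hvv]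
    push_cast
    ring
  have hsum' : star (e + v) ⬝ᵥ e = ((1 + r : ℝ) : ℂ) := by
    rw [star_add, add_dotProduct, hse, hee, hve]
    push_cast
    ring
  have hn : l2norm (e + v) ^ 2 = 2 + 2 * r := by
    rw [← l2norm_sq_eq_dotProduct] at hsum
    exact_mod_cast hsum
  have hn0 : l2norm (e + v) ≠ 0 := fun h => by
    rw [h] at hn
    linarith
  set c : ℝ := (l2norm (e + v))⁻¹ with hc
  have hcn : c ^ 2 * (2 + 2 * r) = 1 := by
    rw [← hn, hc]
    field_simp
  have hw : l2norm ((c : ℂ) • (e + v)) = 1 := by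
    rw [l2norm_smul, Complex.norm_real, Real.norm_of_nonneg (inv_nonneg.2 (l2norm_nonneg _)),
      inv_mul_cancel₀ hn0]
  refine ⟨⟨_, reflectionMatrix_mem hw⟩, ?_⟩
  rw [reflectionMatrix_mulVec, star_smul, smul_dotProduct, hsum', smul_smul]
  have hk : 2 * (star (c : ℂ) • ((1 + r : ℝ) : ℂ)) * (c : ℂ) = 1 := by
    rw [RCLike.star_def, Complex.conj_ofReal, smul_eq_mul]
    norm_cast
    linarith
  rw [hk, one_smul, add_sub_cancel_left]

theorem blockDiagonal_mem {B : μ → Matrix κ κ ℂ} (hB : ∀ k, B k ∈ Matrix.unitaryGroup κ ℂ) :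
    Matrix.blockDiagonal B ∈ Matrix.unitaryGroup (κ × μ) ℂ := by
  rw [Matrix.mem_unitaryGroup_iff, Matrix.star_eq_conjTranspose, Matrix.blockDiagonal_conjTranspose,
    ← Matrix.blockDiagonal_mul, ← Matrix.blockDiagonal_one]
  congr 1
  funext k
  exact Matrix.mem_unitaryGroup_iff.1 (hB k)

omit [DecidableEq κ] in
theorem blockDiagonal_mulVec (B : μ → Matrix κ κ ℂ) (v : κ × μ → ℂ) (i : κ) (k : μ) :
    (Matrix.blockDiagonal B).mulVec v (i, k) = (B k).mulVec (fun j => v (j, k)) i := by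
  simp [Matrix.mulVec, dotProduct, Matrix.blockDiagonal_apply, Fintype.sum_prod_type]

omit [DecidableEq μ] in
open scoped Kronecker in
theorem one_kronecker_mulVec (G : Matrix μ μ ℂ) (v : κ × μ → ℂ) (i : κ) (k : μ) :
    ((1 : Matrix κ κ ℂ) ⊗ₖ G).mulVec v (i, k) = G.mulVec (fun l => v (i, l)) k := by
  simp [Matrix.mulVec, dotProduct, Matrix.one_apply, Fintype.sum_prod_type]

theorem diagonal_mem {d : κ → ℂ} (hd : ∀ i, d i * star (d i) = 1) :
    Matrix.diagonal d ∈ Matrix.unitaryGroup κ ℂ := by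
  rw [Matrix.mem_unitaryGroup_iff, Matrix.star_eq_conjTranspose, Matrix.diagonal_conjTranspose,
    Matrix.diagonal_mul_diagonal, ← Matrix.diagonal_one]
  congr 1
  funext i
  exact hd i

theorem neg_mem_unitaryGroup {U : Matrix κ κ ℂ} (hU : U ∈ Matrix.unitaryGroup κ ℂ) :
    -U ∈ Matrix.unitaryGroup κ ℂ := by
  rw [Matrix.mem_unitaryGroup_iff] at hU ⊢
  rw [star_neg, neg_mul_neg, hU]

/-- The matrix of the permutation `e` of the basis. -/
theorem toPEquiv_toMatrix_mem (e : κ ≃ κ) :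
    (e.toPEquiv.toMatrix : Matrix κ κ ℂ) ∈ Matrix.unitaryGroup κ ℂ := by
  have hs : star (e.toPEquiv.toMatrix : Matrix κ κ ℂ) = e.symm.toPEquiv.toMatrix := by
    ext i j
    simp [Matrix.star_apply, PEquiv.toMatrix_apply, Equiv.toPEquiv_apply, apply_ite,
      Equiv.eq_symm_apply, eq_comm]
  rw [Matrix.mem_unitaryGroup_iff, hs, ← PEquiv.toMatrix_trans, ← Equiv.toPEquiv_trans,
    Equiv.self_trans_symm, Equiv.toPEquiv_refl, PEquiv.toMatrix_refl]

theorem toPEquiv_toMatrix_mulVec (e : κ ≃ κ) (v : κ → ℂ) :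
    (e.toPEquiv.toMatrix : Matrix κ κ ℂ).mulVec v = fun i => v (e i) := by
  funext i
  simp [Matrix.mulVec, dotProduct, PEquiv.toMatrix_apply, Equiv.toPEquiv_apply]

end Unitary

/-! ## The search walk -/

section Walk

variable {κ : Type*} [Fintype κ] [DecidableEq κ]

/-- The uniform superposition. -/
noncomputable def uniformVector (κ : Type*) [Fintype κ] : κ → ℂ :=
  fun _ => ((Real.sqrt (Fintype.card κ))⁻¹ : ℝ)

omit [DecidableEq κ] in
theorem l2norm_uniformVector [Nonempty κ] : l2norm (uniformVector κ) = 1 := by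
  have h : (0 : ℝ) < Fintype.card κ := Nat.cast_pos.2 Fintype.card_pos
  rw [← sq_eq_sq₀ (l2norm_nonneg _) zero_le_one, l2norm_sq]
  simp only [uniformVector, Complex.norm_real, Real.norm_eq_abs, sq_abs, inv_pow,
    Real.sq_sqrt h.le, Finset.sum_const, Finset.card_univ, nsmul_eq_mul]
  rw [mul_inv_cancel₀ h.ne', one_pow]

/-- The phases that a query with the answer qubit in the state `|-⟩` produces. -/
noncomputable def phase (m : κ → Bool) : κ → ℂ := fun u => if m u then -1 else 1

/-- One step of the search walk: a phase query followed by the reflection about the uniform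
superposition. -/
noncomputable def walkMatrix (m : κ → Bool) : Matrix κ κ ℂ :=
  reflectionMatrix (uniformVector κ) * Matrix.diagonal (phase m)

theorem walkMatrix_mem [Nonempty κ] (m : κ → Bool) :
    walkMatrix m ∈ Matrix.unitaryGroup κ ℂ := by
  refine mul_mem (reflectionMatrix_mem l2norm_uniformVector) (diagonal_mem fun i => ?_)
  rw [phase]
  split_ifs <;> simp

/-- The state of the walk after `j` steps. -/
noncomputable def walk (m : κ → Bool) (j : ℕ) : κ → ℂ :=
  (walkMatrix m ^ j).mulVec (uniformVector κ)

theorem walk_zero (m : κ → Bool) : walk m 0 = uniformVector κ := by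
  rw [walk, pow_zero, Matrix.one_mulVec]

theorem walk_succ (m : κ → Bool) (j : ℕ) : walk m (j + 1) =
    (reflectionMatrix (uniformVector κ)).mulVec fun u => phase m u * walk m j u := by
  rw [walk, pow_succ', ← Matrix.mulVec_mulVec, ← walk, walkMatrix, ← Matrix.mulVec_mulVec]
  congr 1
  funext u
  rw [Matrix.mulVec_diagonal]

theorem walk_eq_of_forall_false [Nonempty κ] {m : κ → Bool} (h : ∀ u, m u = false) (j : ℕ) :
    walk m j = uniformVector κ := by
  induction j with
  | zero => exact walk_zero m
  | succ j ih =>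
    have hn : star (uniformVector κ) ⬝ᵥ uniformVector κ = 1 := by
      rw [← l2norm_sq_eq_dotProduct, l2norm_uniformVector]
      simp
    rw [walk_succ, ih]
    simp only [phase, h, Bool.false_eq_true, if_false, one_mul]
    rw [reflectionMatrix_mulVec, hn]
    module

/-- If some element is marked, then the states of the walk cancel on average: the uniform
superposition is `v - W v` for the rescaled superposition `v` of the marked elements. -/
theorem l2norm_sum_walk_sq_le {m : κ → Bool} (h : ∃ u, m u = true) (M : ℕ) :
    l2norm (∑ j ∈ Finset.range M, walk m j) ^ 2 ≤ Fintype.card κ := by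
  obtain ⟨u₀, hu₀⟩ := h
  have : Nonempty κ := ⟨u₀⟩
  have hN : (0 : ℝ) < Fintype.card κ := Nat.cast_pos.2 Fintype.card_pos
  set N : ℝ := (Fintype.card κ : ℝ)
  set K : ℕ := (Finset.univ.filter fun u => m u = true).card with hK
  have hK1 : 1 ≤ K := Finset.card_pos.2 ⟨u₀, by simp [hu₀]⟩
  have hK1' : (1 : ℝ) ≤ K := by exact_mod_cast hK1
  have hsN : Real.sqrt N ^ 2 = N := Real.sq_sqrt hN.le
  have hs0 : Real.sqrt N ≠ 0 := (Real.sqrt_pos.2 hN).ne'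
  -- The scale makes the inner product of the uniform vector with the phase-flipped `v` equal to
  -- `-1/2`, so that the reflection sends `-v` to exactly `v` minus the uniform vector.
  set v : κ → ℂ := fun u => if m u then ((Real.sqrt N / (2 * K) : ℝ) : ℂ) else 0 with hv
  have hvn : l2norm v ^ 2 ≤ N / 4 := by
    rw [l2norm_sq]
    have h1 : ∀ u, ‖v u‖ ^ 2 = if m u then N / (4 * K ^ 2) else 0 := by
      intro u
      simp only [hv]
      split_ifs
      · rw [Complex.norm_real, Real.norm_eq_abs, sq_abs, div_pow, hsN]
        ring
      · simp
    rw [Finset.sum_congr rfl fun u _ => h1 u, ← Finset.sum_filter, Finset.sum_const, ← hK,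
      nsmul_eq_mul]
    rw [show (K : ℝ) * (N / (4 * K ^ 2)) = N / (4 * K) by field_simp]
    gcongr
    linarith
  have hin : star (uniformVector κ) ⬝ᵥ (fun u => phase m u * v u) = -(1 / 2) := by
    have h1 : ∀ u, star (uniformVector κ u) * (phase m u * v u) =
        if m u then (-(1 / (2 * K)) : ℂ) else 0 := by
      intro u
      simp only [hv, phase, uniformVector, RCLike.star_def, Complex.conj_ofReal]
      split_ifs
      · change ((Real.sqrt N)⁻¹ : ℝ) * (-1 * ((Real.sqrt N / (2 * K) : ℝ) : ℂ)) = _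
        have h2 : (Real.sqrt N : ℂ) ≠ 0 := by exact_mod_cast hs0
        push_cast
        field_simp
      · simp
    simp only [dotProduct, Pi.star_apply]
    rw [Finset.sum_congr rfl fun u _ => h1 u, ← Finset.sum_filter, Finset.sum_const, ← hK,
      nsmul_eq_mul]
    have : (K : ℂ) ≠ 0 := by exact_mod_cast (by omega : K ≠ 0)
    field_simp
  have hW : (walkMatrix m).mulVec v = v - uniformVector κ := by
    rw [walkMatrix, ← Matrix.mulVec_mulVec]
    have h1 : (Matrix.diagonal (phase m)).mulVec v = fun u => phase m u * v u := by
      funext u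
      rw [Matrix.mulVec_diagonal]
    have h2 : (fun u => phase m u * v u) = -v := by
      funext u
      simp only [hv, phase, Pi.neg_apply]
      split_ifs <;> simp
    rw [h1, reflectionMatrix_mulVec, hin, h2]
    module
  have hterm : ∀ j, walk m j =
      (walkMatrix m ^ j).mulVec v - (walkMatrix m ^ (j + 1)).mulVec v := by
    intro j
    rw [pow_succ, ← Matrix.mulVec_mulVec, ← Matrix.mulVec_sub, hW, sub_sub_cancel, walk]
  rw [Finset.sum_congr rfl fun j _ => hterm j, Finset.sum_range_sub']
  have h2 := l2norm_sub_le ((walkMatrix m ^ 0).mulVec v) ((walkMatrix m ^ M).mulVec v)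
  rw [l2norm_mulVec (pow_mem (walkMatrix_mem m) _),
    l2norm_mulVec (pow_mem (walkMatrix_mem m) _)] at h2
  nlinarith [l2norm_nonneg v,
    l2norm_nonneg ((walkMatrix m ^ 0).mulVec v - (walkMatrix m ^ M).mulVec v)]

end Walk

/-! ## The search network -/

section Search

variable {a m : ℕ}

/-- The number that is stored in the work qubits other than the output qubit. -/
noncomputable def counter (z : Fin (m + 1) → Bool) : ℕ :=
  Fintype.equivFinOfCardEq (n := 2 ^ m) (α := Fin m → Bool) (by simp) (Fin.init z)

/-- Once the output qubit is fixed to `0`, the counter is a bijection from the remaining work bits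
onto the numbers below `2 ^ m`. -/
theorem sum_counter {R : Type*} [AddCommMonoid R] (F : ℕ → R) :
    ∑ z : Fin (m + 1) → Bool, (if z (Fin.last m) = false then F (counter z) else 0) =
      ∑ j ∈ Finset.range (2 ^ m), F j := by
  rw [← (Fin.snocEquiv fun _ => Bool).sum_comp, Fintype.sum_prod_type]
  have h1 : ∀ (b : Bool) (y : Fin m → Bool),
      (Fin.snocEquiv fun _ => Bool) (b, y) (Fin.last m) = b := fun b y =>
    Fin.snoc_last (α := fun _ => Bool) b y
  have h2 : ∀ (b : Bool) (y : Fin m → Bool),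
      Fin.init ((Fin.snocEquiv fun _ => Bool) (b, y)) = y := fun b y =>
    Fin.init_snoc (α := fun _ => Bool) b y
  simp only [h1, h2, counter, Fintype.sum_bool, Bool.true_eq_false, if_false, if_true,
    Finset.sum_const_zero, zero_add]
  rw [Equiv.sum_comp _ fun i : Fin (2 ^ m) => F i, Finset.sum_range]

theorem counter_lt (z : Fin (m + 1) → Bool) : counter z < 2 ^ m := Fin.is_lt _

theorem sum_basisState {R : Type*} [CommSemiring R] (F : (Fin a → Bool) → R) :
    ∑ s : BasisState a m, (if s.2.2 (Fin.last m) = false then F s.1 else 0) =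
      2 * 2 ^ m * ∑ u, F u := by
  have h : ∀ u, ∑ z : Fin (m + 1) → Bool, (if z (Fin.last m) = false then F u else 0) =
      2 ^ m * F u := by
    intro u
    rw [sum_counter fun _ => F u]
    simp
  simp only [Fintype.sum_prod_type, h]
  simp [Finset.mul_sum, two_mul, add_mul]

/-- The amplitude of each branch of the search network. -/
noncomputable def branchAmplitude (m : ℕ) : ℝ := (Real.sqrt (2 * 2 ^ m))⁻¹

theorem branchAmplitude_sq (m : ℕ) : 2 * 2 ^ m * branchAmplitude m ^ 2 = 1 := by
  rw [branchAmplitude, inv_pow, Real.sq_sqrt (by positivity), mul_inv_cancel₀ (by positivity)]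

/-- The state of the search network after `t` queries: the branch with counter `c` has made
`min t c` steps of the walk; its answer qubit is `|-⟩` before that and `|+⟩` afterwards. -/
noncomputable def searchState (bit : (Fin a → Bool) → Bool) (t : ℕ) : BasisState a m → ℂ :=
  fun s => if s.2.2 (Fin.last m) = false then
    branchAmplitude m * (walk bit (min t (counter s.2.2)) s.1 *
      if s.2.1 = true ∧ t < counter s.2.2 then -1 else 1) else 0

theorem searchState_apply (bit : (Fin a → Bool) → Bool) (t : ℕ) (u : Fin a → Bool) (b : Bool)
    (z : Fin (m + 1) → Bool) : searchState bit t (u, b, z) =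
      if z (Fin.last m) = false then
        branchAmplitude m * (walk bit (min t (counter z)) u *
          if b = true ∧ t < counter z then -1 else 1) else 0 := rfl

/-- One step of the walk in the branches that are still active; branches that become inactive have
their answer qubit changed from `|-⟩` to `|+⟩`. -/
noncomputable def searchBlock (a m t : ℕ) (k : Bool × (Fin (m + 1) → Bool)) :
    Matrix (Fin a → Bool) (Fin a → Bool) ℂ :=
  if t < counter k.2 then
    if k.1 = true ∧ t + 1 = counter k.2 then -reflectionMatrix (uniformVector _)
    else reflectionMatrix (uniformVector _)
  else 1

theorem searchBlock_mem (a m t : ℕ) (k : Bool × (Fin (m + 1) → Bool)) :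
    searchBlock a m t k ∈ Matrix.unitaryGroup (Fin a → Bool) ℂ := by
  have h := reflectionMatrix_mem (l2norm_uniformVector (κ := Fin a → Bool))
  rw [searchBlock]
  split_ifs
  exacts [neg_mem_unitaryGroup h, h, one_mem _]

/-- Phase kickback: in an active branch the answer qubit is `|-⟩`, so the query multiplies by the
phases and the block completes a walk step. In a finished branch it is `|+⟩`, which the query leaves
unchanged, so surplus queries are harmless. -/
theorem blockDiagonal_searchBlock_mulVec {ι : Type} (address : ι ↪ (Fin a → Bool))
    (x : ι → Bool) (t : ℕ) :
    (Matrix.blockDiagonal (searchBlock a m t)).mulVec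
      (fun s => searchState (bitAt address x) t (queryEquiv m address x s)) =
      searchState (bitAt address x) (t + 1) := by
  funext ⟨u, b, z⟩
  rw [blockDiagonal_mulVec]
  change (searchBlock a m t (b, z)).mulVec (fun j => searchState (bitAt address x) t
    (j, b ^^ bitAt address x j, z)) u = _
  simp only [searchState_apply, searchBlock]
  by_cases hz : z (Fin.last m) = false
  swap
  · simp only [hz, Bool.true_eq_false, if_false]
    exact congrFun (Matrix.mulVec_zero _) u
  simp only [hz, if_true]
  by_cases ht : t < counter z
  · have hvec : (fun j => (branchAmplitude m : ℂ) * (walk (bitAt address x) (min t (counter z)) j *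
        if (b ^^ bitAt address x j) = true ∧ t < counter z then -1 else 1)) =
        ((branchAmplitude m : ℂ) * if b then -1 else 1) •
          fun j => phase (bitAt address x) j * walk (bitAt address x) t j := by
      funext j
      rw [min_eq_left ht.le, Pi.smul_apply, smul_eq_mul, phase]
      cases b <;> cases bitAt address x j <;> simp [ht]
    rw [hvec, if_pos ht, min_eq_left ht]
    -- In the last active step the extra sign at answer bit `1` turns `|-⟩` into `|+⟩`.
    rcases (Nat.succ_le_of_lt ht).eq_or_lt with hc | hc
    · have hc' : ¬ t + 1 < counter z := by omega
      have hc'' : t + 1 = counter z := hc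
      cases b <;> simp [hc'', Matrix.mulVec_smul, Matrix.mulVec_neg, Matrix.neg_mulVec, ← walk_succ]
    · have hc' : t + 1 ≠ counter z := by omega
      cases b <;> simp [hc', show t + 1 < counter z from hc, Matrix.mulVec_smul,
        Matrix.mulVec_neg, ← walk_succ]
  · have ht' : ¬ t + 1 < counter z := by omega
    have hmin : min t (counter z) = min (t + 1) (counter z) := by omega
    simp [ht, ht', hmin]

theorem l2norm_searchState_zero (bit : (Fin a → Bool) → Bool) :
    l2norm (searchState (m := m) bit 0) = 1 := by
  rw [← sq_eq_sq₀ (l2norm_nonneg _) zero_le_one, l2norm_sq]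
  have h : ∀ s : BasisState a m, ‖searchState bit 0 s‖ ^ 2 =
      if s.2.2 (Fin.last m) = false then
        branchAmplitude m ^ 2 * ‖uniformVector (Fin a → Bool) s.1‖ ^ 2 else 0 := by
    intro s
    rw [searchState]
    split_ifs <;> simp [walk_zero, mul_pow]
  rw [Finset.sum_congr rfl fun s _ => h s,
    sum_basisState fun u => branchAmplitude m ^ 2 * ‖uniformVector (Fin a → Bool) u‖ ^ 2,
    ← Finset.mul_sum, ← l2norm_sq, l2norm_uniformVector, ← mul_assoc, branchAmplitude_sq]
  norm_num

/-- The unitary transformation that prepares the initial superposition of all branches. -/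
theorem exists_unitary_searchState_zero (a m : ℕ) :
    ∃ U : Matrix.unitaryGroup (BasisState a m) ℂ, ∀ bit : (Fin a → Bool) → Bool,
      U.1.mulVec (Pi.single ((fun _ => false, false, fun _ => false) : BasisState a m) 1) =
        searchState bit 0 := by
  -- No walk step has been made at time `0`, so the state does not depend on the marked elements; an
  -- arbitrary choice of them yields a unitary that serves every black box.
  obtain ⟨U, hU⟩ := exists_unitary_mulVec_single
    (l2norm_searchState_zero (a := a) (m := m) fun _ => false)
    (i := (fun _ => false, false, fun _ => false))
    (r := branchAmplitude m * (Real.sqrt (Fintype.card (Fin a → Bool)))⁻¹)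
    (by unfold branchAmplitude; positivity) (by simp [searchState, walk_zero, uniformVector])
  refine ⟨U, fun bit => hU.trans ?_⟩
  funext s
  simp [searchState, walk_zero]

/-- Negation of the output qubit. -/
def flipOutput (m : ℕ) : (Fin (m + 1) → Bool) ≃ (Fin (m + 1) → Bool) :=
  Function.Involutive.toPerm (fun z => Function.update z (Fin.last m) (!z (Fin.last m))) <| by
    intro z
    simp

theorem flipOutput_last (z : Fin (m + 1) → Bool) :
    flipOutput m z (Fin.last m) = !z (Fin.last m) := by
  exact Function.update_self _ _ _

/-- The normalized difference of the uniform superpositions with output qubit `0` and `1`. -/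
noncomputable def outputDifference (m : ℕ) (z : Fin (m + 1) → Bool) : ℂ :=
  branchAmplitude m * if z (Fin.last m) = false then 1 else -1

theorem l2norm_outputDifference (m : ℕ) : l2norm (outputDifference m) = 1 := by
  rw [← sq_eq_sq₀ (l2norm_nonneg _) zero_le_one, l2norm_sq, one_pow, ← branchAmplitude_sq m]
  have h : ∀ z, ‖outputDifference m z‖ ^ 2 = branchAmplitude m ^ 2 := by
    intro z
    rw [outputDifference]
    split_ifs <;> simp
  rw [Finset.sum_congr rfl fun z _ => h z]
  simp [pow_succ']

/-- The transformation of the work qubits that negates the output qubit unless the counter is in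
the uniform superposition. -/
noncomputable def testMatrix (m : ℕ) : Matrix (Fin (m + 1) → Bool) (Fin (m + 1) → Bool) ℂ :=
  -reflectionMatrix (outputDifference m) * (flipOutput m).toPEquiv.toMatrix

theorem testMatrix_mem (m : ℕ) : testMatrix m ∈ Matrix.unitaryGroup (Fin (m + 1) → Bool) ℂ :=
  mul_mem (neg_mem_unitaryGroup (reflectionMatrix_mem (l2norm_outputDifference m)))
    (toPEquiv_toMatrix_mem _)

/-- After the flip the output qubit is `1`. Negating the vector uniform ⊗ `|-⟩` returns it to `0` on
the uniform component of the counter only, and the amplitude of that component is the mean of `F`.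
-/
theorem testMatrix_mulVec (F : ℕ → ℂ) {z : Fin (m + 1) → Bool} (hz : z (Fin.last m) = false) :
    (testMatrix m).mulVec (fun z => if z (Fin.last m) = false then F (counter z) else 0) z =
      (2 ^ m)⁻¹ * ∑ j ∈ Finset.range (2 ^ m), F j := by
  have hdot : star (outputDifference m) ⬝ᵥ (fun z => if flipOutput m z (Fin.last m) = false
      then F (counter (flipOutput m z)) else 0) =
      -(branchAmplitude m * ∑ j ∈ Finset.range (2 ^ m), F j) := by
    rw [← sum_counter, dotProduct, ← (flipOutput m).sum_comp (fun z =>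
      if z (Fin.last m) = false then F (counter z) else 0), Finset.mul_sum, ← Finset.sum_neg_distrib]
    refine Finset.sum_congr rfl fun z _ => ?_
    rw [Pi.star_apply, outputDifference, flipOutput_last]
    cases z (Fin.last m) <;> simp
  have hb : (2 * 2 ^ m * branchAmplitude m ^ 2 : ℂ) = 1 := by exact_mod_cast branchAmplitude_sq m
  rw [testMatrix, ← Matrix.mulVec_mulVec, toPEquiv_toMatrix_mulVec, Matrix.neg_mulVec,
    reflectionMatrix_mulVec, hdot, Pi.neg_apply, Pi.sub_apply, Pi.smul_apply, flipOutput_last,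
    outputDifference, hz]
  simp only [Bool.not_false, Bool.true_eq_false, if_false, if_true, smul_eq_mul]
  have h2 : ((2 : ℂ) ^ m)⁻¹ = 2 * branchAmplitude m ^ 2 := by
    refine inv_eq_of_mul_eq_one_right ?_
    linear_combination hb
  rw [h2]
  ring

open scoped Kronecker in
/-- The test of the counter as a transformation of the whole state. -/
noncomputable def testUnitary (a m : ℕ) : Matrix.unitaryGroup (BasisState a m) ℂ :=
  ⟨(1 : Matrix (Fin a → Bool) (Fin a → Bool) ℂ) ⊗ₖ ((1 : Matrix Bool Bool ℂ) ⊗ₖ testMatrix m),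
    Matrix.kronecker_mem_unitary (one_mem _)
      (Matrix.kronecker_mem_unitary (one_mem _) (testMatrix_mem m))⟩

/-- The unitary transformation of the search network after `t + 1` queries, without the test. -/
noncomputable def stepUnitary (a m t : ℕ) : Matrix.unitaryGroup (BasisState a m) ℂ :=
  ⟨Matrix.blockDiagonal (searchBlock a m t), blockDiagonal_mem (searchBlock_mem a m t)⟩

/-- The unitary transformations of the search network. -/
noncomputable def searchUnitary (a m : ℕ) : ℕ → Matrix.unitaryGroup (BasisState a m) ℂ
  | 0 => (exists_unitary_searchState_zero a m).choose
  | t + 1 => if t + 1 = 2 ^ m then testUnitary a m * stepUnitary a m t else stepUnitary a m t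

/-- The network that runs the search walk for a uniformly superposed number of steps and tests
whether the counter is left in the uniform superposition. -/
noncomputable def searchNetwork {ι : Type} (m : ℕ) (address : ι ↪ (Fin a → Bool)) :
    QueryNetwork ι where
  queries := 2 ^ m
  addressQubits := a
  workQubits := m
  address := address
  U := searchUnitary a m

theorem searchNetwork_state_succ {ι : Type} (address : ι ↪ (Fin a → Bool)) (x : ι → Bool) {t : ℕ}
    {ψ : BasisState a m → ℂ} (h : (searchNetwork m address).state x t = ψ) :
    (searchNetwork m address).state x (t + 1) = (searchUnitary a m (t + 1)).1.mulVec
      (fun s => ψ (queryEquiv m address x s)) := by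
  subst h
  exact QueryNetwork.state_succ _ x t

theorem searchNetwork_state {ι : Type} (address : ι ↪ (Fin a → Bool)) (x : ι → Bool) {t : ℕ}
    (ht : t < 2 ^ m) :
    (searchNetwork m address).state x t = searchState (m := m) (bitAt address x) t := by
  induction t with
  | zero => exact (exists_unitary_searchState_zero a m).choose_spec _
  | succ t ih =>
    refine (searchNetwork_state_succ address x (ih (by omega))).trans ?_
    rw [searchUnitary, if_neg ht.ne]
    exact blockDiagonal_searchBlock_mulVec address x t

theorem searchNetwork_finalState {ι : Type} (address : ι ↪ (Fin a → Bool)) (x : ι → Bool) :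
    (searchNetwork m address).finalState x =
      (testUnitary a m).1.mulVec (searchState (bitAt address x) (2 ^ m)) := by
  obtain ⟨t, ht⟩ : ∃ t, 2 ^ m = t + 1 := ⟨2 ^ m - 1, by have := Nat.two_pow_pos m; omega⟩
  have h : (searchNetwork m address).finalState x = (searchNetwork m address).state x (t + 1) := by
    rw [← ht]
    rfl
  refine (h.trans (searchNetwork_state_succ address x
    (searchNetwork_state address x (by omega)))).trans ?_
  rw [searchUnitary, if_pos ht.symm, ht, ← blockDiagonal_searchBlock_mulVec address x t,
    Matrix.mulVec_mulVec]
  rfl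

theorem testUnitary_mulVec_searchState (bit : (Fin a → Bool) → Bool) (u : Fin a → Bool) (b : Bool)
    {z : Fin (m + 1) → Bool} (hz : z (Fin.last m) = false) :
    (testUnitary a m).1.mulVec (searchState bit (2 ^ m)) (u, b, z) =
      (2 ^ m)⁻¹ * (branchAmplitude m * (∑ j ∈ Finset.range (2 ^ m), walk bit j) u) := by
  rw [testUnitary, one_kronecker_mulVec, one_kronecker_mulVec, Finset.sum_apply, Finset.mul_sum,
    ← testMatrix_mulVec _ hz]
  congr 1
  funext z'
  -- After `2 ^ m` queries every branch has finished: it has made exactly as many steps as its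
  -- counter says, and its answer qubit is `|+⟩`, hence independent of the counter.
  have h1 := counter_lt z'
  rw [searchState_apply, min_eq_right h1.le]
  simp [h1.not_gt]

theorem searchNetwork_outputProb_false {ι : Type} (address : ι ↪ (Fin a → Bool)) (x : ι → Bool) :
    (searchNetwork m address).outputProb x false =
      l2norm (∑ j ∈ Finset.range (2 ^ m), walk (bitAt address x) j) ^ 2 / (2 ^ m) ^ 2 := by
  set S := ∑ j ∈ Finset.range (2 ^ m), walk (bitAt address x) j with hS
  have h : ∀ s : BasisState a m, (if s.2.2 (Fin.last m) = false then
      ‖(testUnitary a m).1.mulVec (searchState (bitAt address x) (2 ^ m)) s‖ ^ 2 else 0) =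
      if s.2.2 (Fin.last m) = false then
        branchAmplitude m ^ 2 / (2 ^ m) ^ 2 * ‖S s.1‖ ^ 2 else 0 := by
    rintro ⟨u, b, z⟩
    by_cases hz : z (Fin.last m) = false
    · simp only [hz, if_true]
      rw [testUnitary_mulVec_searchState _ u b hz, ← hS]
      simp [mul_pow, div_eq_mul_inv]
      ring
    · simp [hz]
  refine (congrArg (fun ψ : BasisState a m → ℂ => ∑ s : BasisState a m,
    if s.2.2 (Fin.last m) = false then ‖ψ s‖ ^ 2 else 0)
    (searchNetwork_finalState address x)).trans ?_
  refine (Finset.sum_congr rfl fun s _ => h s).trans ?_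
  rw [sum_basisState fun u => branchAmplitude m ^ 2 / (2 ^ m) ^ 2 * ‖S u‖ ^ 2, ← Finset.mul_sum,
    ← l2norm_sq]
  linear_combination l2norm S ^ 2 / (2 ^ m) ^ 2 * branchAmplitude_sq m

theorem searchNetwork_computes {ι : Type} (address : ι ↪ (Fin a → Bool))
    (h : 3 * 2 ^ a ≤ (2 ^ m) ^ 2) :
    (searchNetwork m address).ComputesBoundedError hasEdge := by
  intro x
  have h2 : (0 : ℝ) < (2 ^ m) ^ 2 := by positivity
  by_cases hx : ∃ j, x j = true
  · obtain ⟨j, hj⟩ := hx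
    have hf : hasEdge x = true := by simpa [hasEdge] using ⟨j, hj⟩
    -- The walk runs on all `2 ^ a` addresses, and those naming no variable are unmarked; the error
    -- is at most `2 ^ a / (2 ^ m) ^ 2`, which `h` bounds by `1/3`.
    have h1 := l2norm_sum_walk_sq_le (m := bitAt address x)
      ⟨address j, by rw [bitAt_address, hj]⟩ (2 ^ m)
    have h3 : (searchNetwork m address).outputProb x false ≤ 1 / 3 := by
      rw [searchNetwork_outputProb_false, div_le_iff₀ h2]
      have h4 : (3 * 2 ^ a : ℝ) ≤ (2 ^ m) ^ 2 := by exact_mod_cast h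
      simp only [Fintype.card_fun, Fintype.card_bool, Fintype.card_fin, Nat.cast_pow,
        Nat.cast_ofNat] at h1
      linarith
    have h5 := (searchNetwork m address).outputProb_add_not x false
    rw [hf]
    simp only [Bool.not_false] at h5
    linarith
  · have hf : hasEdge x = false := by simpa [hasEdge] using hx
    have hb : ∀ u, bitAt address x u = false := by
      intro u
      simp only [bitAt, decide_eq_false_iff_not]
      rintro ⟨j, -, hj⟩
      exact hx ⟨j, hj⟩
    rw [hf, searchNetwork_outputProb_false,
      Finset.sum_congr rfl fun j _ => walk_eq_of_forall_false hb j, Finset.sum_const,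
      Finset.card_range, ← Nat.cast_smul_eq_nsmul ℂ, l2norm_smul, l2norm_uniformVector]
    rw [mul_one, Complex.norm_natCast, Nat.cast_pow, Nat.cast_ofNat, div_self h2.ne']
    norm_num

end Search

/-- Searching at most `4 ^ k` variables takes at most `2 ^ (k + 1)` queries. -/
theorem Q₂_hasEdge_le {ι : Type} [Fintype ι] {k : ℕ} (h : Fintype.card ι ≤ 2 ^ (2 * k)) :
    Q₂ (hasEdge (ι := ι)) ≤ (2 ^ (k + 1) : ℕ) := by
  obtain ⟨address⟩ : Nonempty (ι ↪ (Fin (2 * k) → Bool)) :=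
    Function.Embedding.nonempty_of_card_le (by simpa using h)
  refine iInf₂_le (searchNetwork (k + 1) address) (searchNetwork_computes address ?_)
  -- The factor `4` covers the required `3`.
  have : (2 ^ (k + 1)) ^ 2 = 4 * 2 ^ (2 * k) := by ring
  have := Nat.two_pow_pos (2 * k)
  omega

/-- No query is needed when there are no variables. -/
theorem Q₂_hasEdge_of_isEmpty {ι : Type} [IsEmpty ι] : Q₂ (hasEdge (ι := ι)) = 0 := by
  let A : QueryNetwork ι := ⟨0, 0, 0, Function.Embedding.ofIsEmpty, fun _ => 1⟩
  refine le_antisymm (iInf₂_le A fun x => ?_) zero_le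
  have hf : hasEdge x = false := by simp [hasEdge]
  have hs : A.finalState x = Pi.single A.initial 1 := Matrix.one_mulVec _
  rw [hf, QueryNetwork.outputProb, Finset.sum_eq_single A.initial]
  · have h0 : A.initial.2.2 (Fin.last A.workQubits) = false := rfl
    rw [hs, if_pos h0, Pi.single_eq_same]
    norm_num
  · intro s _ h
    rw [hs, Pi.single_eq_of_ne h]
    simp
  · simp

theorem Q₂_hasEdge_le_mul {ι : Type} [Fintype ι] {n : ℕ} (h : Fintype.card ι ≤ n ^ 2) :
    (Q₂ (hasEdge (ι := ι)) : ℝ≥0∞) ≤ ENNReal.ofReal (4 * n) := by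
  -- For `n = 0` the bound is `0`, while the search network always makes at least one query.
  rcases Nat.eq_zero_or_pos n with rfl | hn
  · have : IsEmpty ι := Fintype.card_eq_zero_iff.1 (by simpa using h)
    simp [Q₂_hasEdge_of_isEmpty]
  · set k := Nat.clog 2 n with hk
    have h1 : n ≤ 2 ^ k := Nat.le_pow_clog one_lt_two n
    -- Rounding `n` up to a power of two less than doubles it, and the network for `4 ^ k` addresses
    -- makes `2 * 2 ^ k` queries.
    have h2 : 2 ^ (k + 1) ≤ 4 * n := by
      rcases Nat.lt_or_ge 1 n with h | h
      · have h3 := Nat.pow_pred_clog_lt_self one_lt_two h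
        have h4 : 0 < k := Nat.clog_pos one_lt_two h
        obtain ⟨l, hl⟩ := Nat.exists_eq_succ_of_ne_zero h4.ne'
        rw [← hk, hl, Nat.pred_succ] at h3
        rw [hl, Nat.succ_eq_add_one, pow_succ, pow_succ]
        omega
      · obtain rfl : n = 1 := by omega
        simp [hk]
    have h3 : Q₂ (hasEdge (ι := ι)) ≤ (4 * n : ℕ) := by
      refine (Q₂_hasEdge_le (k := k) ?_).trans (by exact_mod_cast h2)
      rw [mul_comm, pow_mul]
      exact h.trans (Nat.pow_le_pow_left h1 2)
    refine (ENat.toENNReal_le.2 h3).trans_eq ?_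
    rw [ENat.toENNReal_coe, ← ENNReal.ofReal_natCast]
    push_cast
    rfl

theorem card_arc_le (n : ℕ) : Fintype.card (Arc n) ≤ n ^ 2 :=
  (Fintype.card_subtype_le _).trans_eq (by simp [sq])

theorem card_edge_le (n : ℕ) : Fintype.card (Edge n) ≤ n ^ 2 := by
  rw [Sym2.card_subtype_not_diag, Fintype.card_fin, sq, Nat.choose_two_right]
  exact (Nat.div_le_self _ _).trans (Nat.mul_le_mul_left _ (Nat.sub_le _ _))

theorem mainTheorem12 :
    -- every nontrivial monotone property of directed or undirected graphs needs `Ω(√n)` queries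
    (∃ c : ℝ, 0 < c ∧ ∀ n : ℕ,
      (∀ P : (Arc n → Bool) → Bool, IsNontrivialMonotoneDigraphProperty P →
        ENNReal.ofReal (c * Real.sqrt n) ≤ (Q₂ P : ℝ≥0∞)) ∧
      (∀ P : (Edge n → Bool) → Bool, IsNontrivialMonotoneGraphProperty P →
        ENNReal.ofReal (c * Real.sqrt n) ≤ (Q₂ P : ℝ≥0∞))) ∧
    -- "there is at least one edge" is such a property, and `O(n)` queries suffice for it
    (∀ n : ℕ, 2 ≤ n →
      IsNontrivialMonotoneDigraphProperty (n := n) hasEdge ∧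
      IsNontrivialMonotoneGraphProperty (n := n) hasEdge) ∧
    (∃ C : ℝ, 0 < C ∧ ∀ n : ℕ,
      (Q₂ (hasEdge (ι := Arc n)) : ℝ≥0∞) ≤ ENNReal.ofReal (C * n) ∧
      (Q₂ (hasEdge (ι := Edge n)) : ℝ≥0∞) ≤ ENNReal.ofReal (C * n)) := by
  exact ⟨⟨1 / 20, by norm_num, fun n => ⟨fun P hP => ofReal_sqrt_le_Q₂_of_digraphProperty hP,
      fun P hP => ofReal_sqrt_le_Q₂_of_graphProperty hP⟩⟩,
    fun n hn => ⟨isNontrivialMonotoneDigraphProperty_hasEdge hn,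
      isNontrivialMonotoneGraphProperty_hasEdge hn⟩,
    ⟨4, by norm_num, fun n => ⟨Q₂_hasEdge_le_mul (card_arc_le n), Q₂_hasEdge_le_mul (card_edge_le n)⟩⟩⟩
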